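/- Let $\lambda\in\mathbb{R}$ with $|\lambda|>1$, let $a_1,\dots,a_m\in\mathbb{C}\setminus\{0\}$ with $a_1+\cdots+a_m=|\lambda|$, let $\tau_1<\cdots<\tau_m$ be real numbers, and put $$A(y)=|\lambda|^{-1}\sum_{j=1}^m a_j e^{2\pi i\tau_j y},\qquad y\in\mathbb{R}.$$ Then: (1) $\ln|A|$ is almost periodic in the mean-square sense of Besicovitch: it is locally square integrable and for every $\varepsilon>0$ there is a trigonometric polynomial $Q(y)=\sum_k c_k e^{2\pi i s_k y}$ (a finite sum with $s_k\in\mathbb{R}$, $c_k\in\mathbb{C}$) such that $\limsup_{L\to\infty}\frac1{2L}\int_{-L}^{L}\bigl|\ln|A(y)|-Q(y)\bigr|^2dy<\varepsilon$. (2) Let $d$ be the dimension of the $\mathbb{Q}$-linear span of $\tau_1,\dots,\tau_m$. There are real numbers $r_1,\dots,r_d$, linearly independent over $\mathbb{Q}$, and a complex Laurent polynomial $P(z_1,\dots,z_d)$ such that $$A(y)=P(e^{2\pi i r_1y},\dots,e^{2\pi i r_dy})\quad\text{for all } y\in\mathbb{R}.\qquad(*)$$ (3) For every $d\ge 0$,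 all real numbers $r_1,\dots,r_d$ that are linearly independent over $\mathbb{Q}$, and every complex Laurent polynomial $P(z_1,\dots,z_d)$ for which $(*)$ holds, the function $t\mapsto\ln|P(e^{2\pi i t_1},\dots,e^{2\pi i t_d})|$ is integrable on $[0,1]^d$ and $$\lim_{L\to\infty}\frac1{2L}\int_{-L}^{L}\ln|A(y)|\,dy=\ln M(P),$$ where $M(P)=\exp\int_{[0,1]^d}\ln|P(e^{2\pi i t_1},\dots,e^{2\pi i t_d})|\,dt$ is the Mahler measure of $P$. -/

import Mathlib

open Filter Topology MeasureTheory
open scoped ENNReal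

noncomputable section

/-- The trigonometric polynomial `A(y) = |lam|⁻¹ ∑ⱼ aⱼ e^{2πi τⱼ y}`. -/
def trigA {m : ℕ} (lam : ℝ) (a : Fin m → ℂ) (τ : Fin m → ℝ) (y : ℝ) : ℂ :=
  ((|lam|⁻¹ : ℝ) : ℂ) * ∑ j, a j * Complex.exp (2 * Real.pi * Complex.I * (τ j * y))

/-- Complex Laurent polynomials in `d` variables `z₁, …, z_d`: finite sums of monomials
`c z₁ ^ n₁ ⋯ z_d ^ n_d` with integer exponents. -/
abbrev LaurentPoly (d : ℕ) : Type := AddMonoidAlgebra ℂ (Fin d → ℤ)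

/-- Value of a Laurent polynomial at a point with nonzero coordinates. -/
def LaurentPoly.evalAt {d : ℕ} (P : LaurentPoly d) (z : Fin d → ℂ) : ℂ :=
  ∑ n ∈ P.coeff.support, P.coeff n * ∏ i, z i ^ n i

/-- `P(e^{2πi t₁}, …, e^{2πi t_d})` as a function of `t ∈ ℝᵈ`. -/
def LaurentPoly.onTorus {d : ℕ} (P : LaurentPoly d) (t : Fin d → ℝ) : ℂ :=
  P.evalAt fun i => Complex.exp (2 * Real.pi * Complex.I * t i)

/-- The Mahler measure `M(P) = exp ∫_{[0,1]^d} ln |P(e^{2πi t₁}, …, e^{2πi t_d})| dt`. -/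
def LaurentPoly.mahler {d : ℕ} (P : LaurentPoly d) : ℝ :=
  Real.exp (∫ t in Set.Icc (0 : Fin d → ℝ) 1, Real.log ‖P.onTorus t‖)

/-- The generalized trigonometric polynomial `∑ₛ cₛ e^{2πi s y}` with arbitrary real
frequencies, given by its finitely supported coefficient function. -/
def genTrigPoly (c : ℝ →₀ ℂ) (y : ℝ) : ℂ :=
  ∑ s ∈ c.support, c s * Complex.exp (2 * Real.pi * Complex.I * (s * y))

/-- The square of the Besicovitch seminorm,
`limsup_{L → ∞} (1 / 2L) ∫_{-L}^{L} |f|²`, with values in `[0, ∞]`. -/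
def besicovitchSq (f : ℝ → ℂ) : ℝ≥0∞ :=
  limsup (fun L : ℝ => (∫⁻ y in Set.Icc (-L) L, ‖f y‖ₑ ^ 2) / ENNReal.ofReal (2 * L)) atTop

/-- Mean-square (`B²`) almost periodicity in the sense of Besicovitch: `f` is locally square
integrable and lies in the closure of the trigonometric polynomials for the
Besicovitch seminorm. -/
structure IsBesicovitchAP (f : ℝ → ℂ) : Prop where
  memLp_loc : ∀ L : ℝ, MemLp f 2 (volume.restrict (Set.Icc (-L) L))
  approx : ∀ ε : ℝ≥0∞, 0 < ε → ∃ c : ℝ →₀ ℂ, besicovitchSq (fun y => f y - genTrigPoly c y) < ε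

end

noncomputable section

/-! `A` is the restriction of a continuous function on a torus to the line `y ↦ r y`. Were `log`
continuous at `0`, density of trigonometric polynomials on the torus would give almost periodicity,
and Weyl equidistribution would give the mean value. So `log` is truncated below at height `-k`, and
everything rests on bounding the truncation error in the mean, uniformly in the length `L` of the
averaging interval.

The bound comes from the sublevel estimate `exists_volume_sublevel_le`: on windows of a fixed short
length, the set where `|A| ≤ δ` has measure at most `C δ ^ α`, wherever the window lies. The proof
is by induction on the number of frequencies. After normalising one term to `1`, the combination `f
(y + h) - e^{2πi t h} f y` removes the frequency `t`. It is small wherever `f y` and `f (y + h)`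
both are, so the inductive hypothesis bounds the autocorrelation of the sublevel set, whose integral
over `h` is the square of its measure.

Summing over the levels `e^{-k}` bounds the mean of `|log |A|| ^ 3`
(`exists_lintegral_log_expSum_le`). The cube leaves one power to spare over the square, so the
mean-square truncation error is `O(1 / k)`. By Weyl's theorem (`tendsto_mean_torusMk`) the bounds on
the line pass to the truncations on the torus, where Markov's inequality and Fatou's lemma yield
integrability of `log |P|`. -/

/-! ### The additive character `x ↦ e^{2πix}` -/

/-- The character `x ↦ e^{2πix}` of `ℝ`. -/
def expChar (x : ℝ) : ℂ := Complex.exp (2 * Real.pi * Complex.I * x)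

lemma expChar_add (x y : ℝ) : expChar (x + y) = expChar x * expChar y := by
  simp only [expChar, ← Complex.exp_add]
  congr 1
  push_cast
  ring

lemma expChar_zero : expChar 0 = 1 := by simp [expChar]

lemma norm_expChar (x : ℝ) : ‖expChar x‖ = 1 := by
  rw [expChar, show (2 * Real.pi * Complex.I * x : ℂ) = ((2 * Real.pi * x : ℝ) : ℂ) * Complex.I by
    push_cast; ring]
  exact Complex.norm_exp_ofReal_mul_I _

lemma expChar_sub (x y : ℝ) : expChar (x - y) * expChar y = expChar x := by
  rw [← expChar_add, sub_add_cancel]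

lemma expChar_sum {ι : Type*} (s : Finset ι) (f : ι → ℝ) :
    expChar (∑ i ∈ s, f i) = ∏ i ∈ s, expChar (f i) := by
  simp only [expChar, ← Complex.exp_sum, Complex.ofReal_sum, Finset.mul_sum]

lemma expChar_zpow (x : ℝ) (n : ℤ) : expChar x ^ n = expChar (n * x) := by
  simp only [expChar, ← Complex.exp_int_mul]
  congr 1
  push_cast
  ring

@[fun_prop]
lemma continuous_expChar : Continuous expChar := by
  unfold expChar
  fun_prop

/-- The norm is `2 |sin πx|`, and Jordan's inequality bounds the sine below. -/
lemma four_mul_abs_le_norm_expChar_sub_one {x : ℝ} (hx : |x| ≤ 1 / 2) :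
    4 * |x| ≤ ‖expChar x - 1‖ := by
  have h : expChar x = Complex.exp (Complex.I * ((2 * Real.pi * x : ℝ) : ℂ)) := by
    rw [expChar]
    congr 1
    push_cast
    ring
  have h2 : |Real.pi * x| ≤ Real.pi / 2 := by
    rw [abs_mul, abs_of_pos Real.pi_pos]
    nlinarith [Real.pi_pos]
  have h3 := Real.mul_abs_le_abs_sin h2
  rw [abs_mul, abs_of_pos Real.pi_pos, ← mul_assoc, div_mul_cancel₀ _ Real.pi_ne_zero] at h3
  rw [h, Complex.norm_exp_I_mul_ofReal_sub_one, Real.norm_eq_abs, abs_mul, abs_two,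
    show 2 * Real.pi * x / 2 = Real.pi * x by ring]
  linarith

/-! ### Sublevel sets of exponential sums -/

lemma integrableOn_abs_rpow_Icc {α : ℝ} (hα : α < 1) (l : ℝ) :
    IntegrableOn (fun h : ℝ => |h| ^ (-α)) (Set.Icc (-l) l) := by
  have h1 : IntegrableOn (fun h : ℝ => |h| ^ (-α)) (Set.Ioc 0 l) := by
    rcases le_total l 0 with hl | hl
    · simp [Set.Ioc_eq_empty (not_lt.2 hl)]
    have := (intervalIntegral.intervalIntegrable_rpow' (a := 0) (b := l) (r := -α) (by linarith)).1
    refine this.congr_fun (fun x hx => ?_) measurableSet_Ioc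
    simp only [abs_of_pos hx.1]
  have h2 : IntegrableOn (fun h : ℝ => |h| ^ (-α)) (Set.Ico (-l) 0) := by
    have := h1.comp_neg
    simpa using this
  have h3 : IntegrableOn (fun h : ℝ => |h| ^ (-α)) {0} := by
    simp [IntegrableOn, Measure.restrict_singleton]
  refine ((h2.union h3).union h1).mono_set fun x hx => ?_
  rcases lt_trichotomy x 0 with h | h | h
  · exact .inl (.inl ⟨hx.1, h⟩)
  · exact .inl (.inr h)
  · exact .inr ⟨h, hx.2⟩

/-- The square of the measure of `E` is the integral of its autocorrelation. -/
lemma volume_sq_eq_lintegral_inter {E : Set ℝ} (hE : MeasurableSet E) :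
    volume E ^ 2 = ∫⁻ h : ℝ, volume (E ∩ {y | y + h ∈ E}) := by
  have hm : Measurable (E.indicator (1 : ℝ → ℝ≥0∞)) := measurable_one.indicator hE
  have key : ∀ h : ℝ, volume (E ∩ {y | y + h ∈ E}) =
      ∫⁻ y, E.indicator 1 y * E.indicator 1 (y + h) := by
    intro h
    have hS : MeasurableSet (E ∩ {y | y + h ∈ E}) :=
      hE.inter (measurable_id.add_const h hE)
    rw [← lintegral_indicator_one hS]
    refine lintegral_congr fun y => ?_
    by_cases h1 : y ∈ E <;> by_cases h2 : y + h ∈ E <;> simp [Set.indicator, h1, h2]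
  simp_rw [key]
  rw [lintegral_lintegral_swap]
  · have : ∀ y : ℝ, ∫⁻ h, E.indicator (1 : ℝ → ℝ≥0∞) y * E.indicator 1 (y + h) =
        E.indicator 1 y * volume E := by
      intro y
      rw [lintegral_const_mul _ (show Measurable fun h => E.indicator (1 : ℝ → ℝ≥0∞) (y + h) from
          hm.comp (measurable_const_add y)),
        lintegral_add_left_eq_self (fun h => E.indicator (1 : ℝ → ℝ≥0∞) h) y,
        lintegral_indicator_one hE]
    simp_rw [this]
    rw [lintegral_mul_const _ hm, lintegral_indicator_one hE, sq]
  · exact ((hm.comp measurable_snd).mul (hm.comp (measurable_snd.add measurable_fst))).aemeasurable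

/-- Sublevel sets of exponential sums with constant term `1` and frequencies small compared to the
inverse length of a window have small measure in the window, uniformly in the other coefficients
and in the position of the window. -/
lemma exists_volume_sublevel_le {ι : Type*} [DecidableEq ι] (l : ℝ) (t : ι → ℝ)
    (s : Finset ι) (hs : ∀ j ∈ s, t j ≠ 0 ∧ |t j| * l ≤ 1 / 2) :
    ∃ C : ℝ≥0∞, C ≠ ⊤ ∧ ∃ α : ℝ, 0 < α ∧ α < 1 ∧ ∀ (c : ι → ℂ) (x δ : ℝ), 0 < δ →
      volume (Set.Icc x (x + l) ∩ {y | ‖1 + ∑ j ∈ s, c j * expChar (t j * y)‖ ≤ δ}) ≤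
        C * ENNReal.ofReal (δ ^ α) := by
  induction s using Finset.induction_on with
  | empty =>
    -- The sum is the constant `1`: its sublevel set is empty for `δ < 1`, and for `δ ≥ 1` the whole
    -- window is allowed. Any exponent in `(0, 1)` would do.
    refine ⟨ENNReal.ofReal l, ENNReal.ofReal_ne_top, 1 / 2, by norm_num, by norm_num, ?_⟩
    intro c x δ hδ
    rcases lt_or_ge δ 1 with h | h
    · simp [not_le.2 h]
    · calc _ ≤ volume (Set.Icc x (x + l)) := measure_mono Set.inter_subset_left
        _ = ENNReal.ofReal l * 1 := by simp
        _ ≤ _ := by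
          gcongr
          rw [← ENNReal.ofReal_one]
          exact ENNReal.ofReal_le_ofReal (Real.one_le_rpow h (by norm_num))
  | insert i s hi ih =>
    obtain ⟨C, hC, α, hα0, hα1, H⟩ := ih fun j hj => hs j (Finset.mem_insert_of_mem hj)
    obtain ⟨hti, htl⟩ := hs i (Finset.mem_insert_self i s)
    have hti' : 0 < |t i| := abs_pos.2 hti
    set K : ℝ≥0∞ := ∫⁻ h in Set.Icc (-l) l, ENNReal.ofReal ((2 * |t i|) ^ (-α) * |h| ^ (-α)) with hK
    have hKt : K ≠ ⊤ := ((integrableOn_abs_rpow_Icc hα1 l).const_mul _).lintegral_lt_top.ne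
    -- The estimate is proved for `volume E ^ 2`; the square root halves the exponent.
    refine ⟨(C * K) ^ (1 / 2 : ℝ), ENNReal.rpow_ne_top_of_nonneg (by norm_num)
      (ENNReal.mul_ne_top hC hKt), α / 2, by linarith, by linarith, ?_⟩
    intro c x δ hδ
    set f : ℝ → ℂ := fun y => 1 + ∑ j ∈ insert i s, c j * expChar (t j * y) with hf
    have hfc : Continuous f := by fun_prop
    set E : Set ℝ := Set.Icc x (x + l) ∩ {y | ‖f y‖ ≤ δ} with hEdef
    have hE : MeasurableSet E :=
      measurableSet_Icc.inter (isClosed_le hfc.norm continuous_const).measurableSet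
    have hcorr : ∀ h : ℝ, h ≠ 0 → volume (E ∩ {y | y + h ∈ E}) ≤
        (Set.Icc (-l) l).indicator (fun h => C * ENNReal.ofReal (δ ^ α) *
          ENNReal.ofReal ((2 * |t i|) ^ (-α) * |h| ^ (-α))) h := by
      intro h h0
      have h0' : 0 < |h| := abs_pos.2 h0
      by_cases hh : h ∈ Set.Icc (-l) l
      · rw [Set.indicator_of_mem hh]
        have hhl : |h| ≤ l := abs_le.2 hh
        have hth : |t i * h| ≤ 1 / 2 := by
          rw [abs_mul]
          exact (mul_le_mul_of_nonneg_left hhl hti'.le).trans htl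
        set w : ℂ := 1 - expChar (t i * h) with hw
        have hwn : 4 * |t i| * |h| ≤ ‖w‖ := by
          rw [hw, norm_sub_rev, mul_assoc, ← abs_mul]
          exact four_mul_abs_le_norm_expChar_sub_one hth
        have hw0 : 0 < ‖w‖ := lt_of_lt_of_le (by positivity) hwn
        have hwne : w ≠ 0 := norm_pos_iff.1 hw0
        have hsub : E ∩ {y | y + h ∈ E} ⊆ Set.Icc x (x + l) ∩
            {y | ‖1 + ∑ j ∈ s, (c j * (expChar (t j * h) - expChar (t i * h)) / w) *
              expChar (t j * y)‖ ≤ δ / (2 * |t i| * |h|)} := by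
          rintro y ⟨⟨hy, hy1⟩, -, hy2⟩
          refine ⟨hy, ?_⟩
          simp only [Set.mem_ofPred_eq] at hy1 hy2 ⊢
          -- The term of frequency `t i` cancels. The remaining coefficients depend on `h` and blow
          -- up as `w → 0`, which is why the induction needs uniformity in `c`.
          have hid : w * (1 + ∑ j ∈ s, (c j * (expChar (t j * h) - expChar (t i * h)) / w) *
              expChar (t j * y)) = f (y + h) - expChar (t i * h) * f y := by
            simp only [hf, Finset.sum_insert hi, mul_add, expChar_add, Finset.mul_sum]
            have : ∀ j, w * (c j * (expChar (t j * h) - expChar (t i * h)) / w *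
                expChar (t j * y)) = c j * (expChar (t j * y) * expChar (t j * h)) -
                expChar (t i * h) * (c j * expChar (t j * y)) := by
              intro j
              field_simp
            simp only [this, Finset.sum_sub_distrib]
            rw [hw]
            ring
          -- Dividing `2 δ` by the lower bound `4 |t i| |h|` for `‖w‖` gives the threshold `δ / (2
          -- |t i| |h|)`.
          have hnorm : ‖f (y + h) - expChar (t i * h) * f y‖ ≤ δ + δ := by
            refine (norm_sub_le _ _).trans (add_le_add hy2 ?_)
            rwa [norm_mul, norm_expChar, one_mul]
          rw [← hid, norm_mul] at hnorm
          rw [le_div_iff₀ (by positivity)]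
          nlinarith [norm_nonneg (1 + ∑ j ∈ s, (c j * (expChar (t j * h) - expChar (t i * h)) / w) *
            expChar (t j * y))]
        refine (measure_mono hsub).trans ((H _ x _ (by positivity)).trans (le_of_eq ?_))
        rw [mul_assoc C, ← ENNReal.ofReal_mul (by positivity)]
        congr 2
        rw [Real.div_rpow hδ.le (by positivity), Real.mul_rpow (by positivity) h0'.le,
          Real.rpow_neg (by positivity), Real.rpow_neg h0'.le]
        field_simp
      · have : E ∩ {y | y + h ∈ E} = ∅ := by
          ext y
          simp only [Set.mem_inter_iff, Set.mem_empty_iff_false, iff_false, not_and]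
          intro h1 h2
          have h1 := h1.1
          have h2 := h2.1
          exact hh ⟨by linarith [h1.2, h2.1], by linarith [h1.1, h2.2]⟩
        simp [this]
    have hsq : volume E ^ 2 ≤ C * K * ENNReal.ofReal (δ ^ α) := by
      rw [volume_sq_eq_lintegral_inter hE]
      calc _ ≤ ∫⁻ h : ℝ, (Set.Icc (-l) l).indicator (fun h => C * ENNReal.ofReal (δ ^ α) *
          ENNReal.ofReal ((2 * |t i|) ^ (-α) * |h| ^ (-α))) h := by
            refine lintegral_mono_ae ?_
            filter_upwards [compl_mem_ae_iff.2 (measure_singleton (0 : ℝ))] with h h0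
            exact hcorr h h0
        _ = C * ENNReal.ofReal (δ ^ α) * K := by
            rw [lintegral_indicator measurableSet_Icc, lintegral_const_mul]
            fun_prop
        _ = _ := by ring
    calc volume E = (volume E ^ 2) ^ (1 / 2 : ℝ) := by
          rw [← ENNReal.rpow_natCast, ← ENNReal.rpow_mul]
          norm_num
      _ ≤ (C * K * ENNReal.ofReal (δ ^ α)) ^ (1 / 2 : ℝ) := by gcongr
      _ = _ := by
          rw [ENNReal.mul_rpow_of_nonneg _ _ (by norm_num),
            ENNReal.ofReal_rpow_of_nonneg (by positivity) (by norm_num), ← Real.rpow_mul hδ.le]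
          congr 3
          ring

/-! ### Uniform integrability of the logarithm of an exponential sum -/

/-- The exponential sum `∑ⱼ cⱼ e^{2πi τⱼ y}`. -/
def expSum {ι : Type*} [Fintype ι] (c : ι → ℂ) (τ : ι → ℝ) (y : ℝ) : ℂ :=
  ∑ j, c j * expChar (τ j * y)

@[fun_prop]
lemma continuous_expSum {ι : Type*} [Fintype ι] (c : ι → ℂ) (τ : ι → ℝ) :
    Continuous (expSum c τ) := by
  unfold expSum
  fun_prop

lemma norm_expSum_le {ι : Type*} [Fintype ι] (c : ι → ℂ) (τ : ι → ℝ) (y : ℝ) :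
    ‖expSum c τ y‖ ≤ ∑ j, ‖c j‖ :=
  (norm_sum_le _ _).trans (by simp [norm_expChar])

/-- Factoring out the `i`-th term leaves the constant `1` and the frequencies `τ j - τ i`, nonzero
by injectivity. The window length `l` is chosen so that all of them satisfy `|τ j - τ i| * l ≤ 1 /
2`. -/
lemma exists_volume_expSum_le {ι : Type*} [Fintype ι] {c : ι → ℂ} {τ : ι → ℝ}
    (hτ : Function.Injective τ) {i : ι} (hi : c i ≠ 0) :
    ∃ l : ℝ, 0 < l ∧ ∃ C : ℝ≥0∞, C ≠ ⊤ ∧ ∃ α : ℝ, 0 < α ∧ ∀ x δ : ℝ, 0 < δ →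
      volume (Set.Icc x (x + l) ∩ {y | ‖expSum c τ y‖ ≤ δ}) ≤ C * ENNReal.ofReal (δ ^ α) := by
  classical
  set T : ℝ := ∑ j, |τ j - τ i| with hT
  have hT0 : 0 ≤ T := Finset.sum_nonneg fun _ _ => abs_nonneg _
  set l : ℝ := 1 / (2 * (1 + T)) with hl
  have hl0 : 0 < l := by positivity
  obtain ⟨C, hC, α, hα0, -, H⟩ := exists_volume_sublevel_le l (fun j => τ j - τ i)
    (Finset.univ.erase i) (fun j hj => by
      refine ⟨sub_ne_zero.2 fun h => (Finset.mem_erase.1 hj).1 (hτ h), ?_⟩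
      have : |τ j - τ i| ≤ T :=
        Finset.single_le_sum (f := fun j => |τ j - τ i|) (fun _ _ => abs_nonneg _)
          (Finset.mem_univ j)
      rw [hl, mul_one_div, div_le_div_iff₀ (by positivity) (by norm_num)]
      linarith)
  have hci : 0 < ‖c i‖ := norm_pos_iff.2 hi
  refine ⟨l, hl0, C * ENNReal.ofReal (‖c i‖⁻¹ ^ α), ENNReal.mul_ne_top hC ENNReal.ofReal_ne_top, α,
    hα0, fun x δ hδ => ?_⟩
  have hfac : ∀ y, ‖expSum c τ y‖ = ‖c i‖ *
      ‖1 + ∑ j ∈ Finset.univ.erase i, c j / c i * expChar ((τ j - τ i) * y)‖ := by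
    intro y
    have : expSum c τ y = expChar (τ i * y) * (c i *
        (1 + ∑ j ∈ Finset.univ.erase i, c j / c i * expChar ((τ j - τ i) * y))) := by
      rw [expSum, ← Finset.add_sum_erase _ _ (Finset.mem_univ i)]
      simp only [mul_add, Finset.mul_sum]
      congr 1
      · ring
      · refine Finset.sum_congr rfl fun j _ => ?_
        rw [← expChar_sub (τ j * y) (τ i * y), ← sub_mul]
        field_simp
    rw [this, norm_mul, norm_expChar, one_mul, norm_mul]
  refine (measure_mono ?_).trans ((H (fun j => c j / c i) x (δ * ‖c i‖⁻¹) (by positivity)).trans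
    (le_of_eq ?_))
  · rintro y ⟨hy, hy1⟩
    refine ⟨hy, ?_⟩
    simp only [Set.mem_ofPred_eq, hfac] at hy1 ⊢
    rw [← div_eq_mul_inv, le_div_iff₀ hci]
    linarith
  · rw [Real.mul_rpow hδ.le (by positivity), ENNReal.ofReal_mul (by positivity)]
    ring

/-- Let `δ → 0` in the sublevel estimate, and cover the line by countably many windows. -/
lemma ae_expSum_ne_zero {ι : Type*} [Fintype ι] {c : ι → ℂ} {τ : ι → ℝ}
    (hτ : Function.Injective τ) {i : ι} (hi : c i ≠ 0) : ∀ᵐ y, expSum c τ y ≠ 0 := by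
  obtain ⟨l, hl, C, hC, α, hα, H⟩ := exists_volume_expSum_le hτ hi
  have hw : ∀ x : ℝ, volume (Set.Icc x (x + l) ∩ {y | expSum c τ y = 0}) = 0 := by
    intro x
    have hlim : Tendsto (fun δ : ℝ => C * ENNReal.ofReal (δ ^ α)) (𝓝[>] 0) (𝓝 0) := by
      have h1 : Tendsto (fun δ : ℝ => δ ^ α) (𝓝[>] 0) (𝓝 0) := by
        have := (Real.continuousAt_rpow_const 0 α (.inr hα.le)).tendsto
        rw [Real.zero_rpow hα.ne'] at this
        exact this.mono_left nhdsWithin_le_nhds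
      have h2 := ENNReal.Tendsto.const_mul (ENNReal.tendsto_ofReal h1) (.inr hC)
      simpa using h2
    refine le_antisymm (ge_of_tendsto hlim ?_) bot_le
    filter_upwards [self_mem_nhdsWithin] with δ hδ
    refine (measure_mono (Set.inter_subset_inter_right _ fun y hy => ?_)).trans (H x δ hδ)
    simp only [Set.mem_ofPred_eq] at hy ⊢
    simpa [hy] using (Set.mem_Ioi.1 hδ).le
  refine measure_mono_null (t := ⋃ n : ℤ, Set.Icc (n * l) (n * l + l) ∩ {y | expSum c τ y = 0})
    (fun y hy => ?_) (measure_iUnion_null fun n => hw _)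
  have h1 := Int.floor_le (y / l)
  have h2 := Int.lt_floor_add_one (y / l)
  rw [le_div_iff₀ hl] at h1
  rw [div_lt_iff₀ hl] at h2
  exact Set.mem_iUnion.2 ⟨⌊y / l⌋, ⟨h1, by linarith⟩, by simpa using hy⟩

/-- For `u < 1` the single term `k = ⌊-log u⌋` of the series already dominates, since `u ≤ e^{-k}`
and `|log u| < k + 1`. -/
lemma enorm_log_pow_three_le {u M : ℝ} (hu : 0 ≤ u) (huM : u ≤ M) :
    ‖Real.log u‖ₑ ^ 3 ≤ ENNReal.ofReal (Real.log M ^ 3) +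
      ∑' k : ℕ, {v : ℝ | v ≤ Real.exp (-k)}.indicator
        (fun _ => ENNReal.ofReal ((k + 1) ^ 3)) u := by
  rcases hu.eq_or_lt with rfl | hu
  -- Here `Real.log 0 = 0` makes the left side vanish.
  · simp
  rcases le_or_gt 1 u with h1 | h1
  · refine le_add_right ?_
    have := Real.log_nonneg h1
    rw [Real.enorm_eq_ofReal this, ← ENNReal.ofReal_pow this]
    refine ENNReal.ofReal_le_ofReal (pow_le_pow_left₀ this (Real.log_le_log hu huM) 3)
  · refine le_add_left (le_trans ?_ (ENNReal.le_tsum ⌊-Real.log u⌋₊))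
    have hlog : 0 ≤ -Real.log u := by linarith [Real.log_neg hu h1]
    have hfl := Nat.floor_le hlog
    have hfl' := Nat.lt_floor_add_one (-Real.log u)
    rw [Set.indicator_of_mem, ← enorm_neg, Real.enorm_eq_ofReal hlog, ← ENNReal.ofReal_pow hlog]
    · exact ENNReal.ofReal_le_ofReal (pow_le_pow_left₀ hlog hfl'.le 3)
    · simp only [Set.mem_ofPred_eq]
      rw [← Real.log_le_iff_le_exp hu]
      linarith

/-- Integrating the level decomposition leaves the convergent series `∑ (k + 1) ^ 3 C e^{-αk}`,
which does not involve the position of the window. -/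
lemma exists_lintegral_window_le {f : ℝ → ℂ} (hf : Continuous f) {M : ℝ} (hM : ∀ y, ‖f y‖ ≤ M)
    {l : ℝ} {C : ℝ≥0∞} (hC : C ≠ ⊤) {α : ℝ} (hα : 0 < α)
    (H : ∀ x δ : ℝ, 0 < δ →
      volume (Set.Icc x (x + l) ∩ {y | ‖f y‖ ≤ δ}) ≤ C * ENNReal.ofReal (δ ^ α)) :
    ∃ B : ℝ≥0∞, B ≠ ⊤ ∧
      ∀ x : ℝ, ∫⁻ y in Set.Icc x (x + l), ‖Real.log ‖f y‖‖ₑ ^ 3 ≤ B := by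
  have hS : ∑' k : ℕ, ENNReal.ofReal ((k + 1) ^ 3) *
      (C * ENNReal.ofReal (Real.exp (-k) ^ α)) ≠ ⊤ := by
    have h1 : ∀ k : ℕ, ENNReal.ofReal (((k : ℝ) + 1) ^ 3) *
        (C * ENNReal.ofReal (Real.exp (-k) ^ α)) =
        C * ENNReal.ofReal (((k : ℝ) + 1) ^ 3 * Real.exp (-α * k)) := by
      intro k
      rw [ENNReal.ofReal_mul (by positivity), ← Real.exp_mul]
      ring_nf
    simp_rw [h1]
    rw [ENNReal.tsum_mul_left]
    refine ENNReal.mul_ne_top hC (Summable.tsum_ofReal_ne_top ?_)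
    have h2 := (summable_nat_add_iff 1).2 (Real.summable_pow_mul_exp_neg_nat_mul 3 hα)
    refine (h2.mul_left (Real.exp α)).congr fun k => ?_
    rw [mul_left_comm, ← Real.exp_add]
    push_cast
    ring_nf
  refine ⟨ENNReal.ofReal (Real.log M ^ 3) * ENNReal.ofReal l + _, ENNReal.add_ne_top.2
    ⟨ENNReal.mul_ne_top ENNReal.ofReal_ne_top ENNReal.ofReal_ne_top, hS⟩, fun x => ?_⟩
  have hmeas : ∀ k : ℕ, MeasurableSet {y | ‖f y‖ ≤ Real.exp (-k)} := fun k =>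
    (isClosed_le hf.norm continuous_const).measurableSet
  calc ∫⁻ y in Set.Icc x (x + l), ‖Real.log ‖f y‖‖ₑ ^ 3
      ≤ ∫⁻ y in Set.Icc x (x + l), (ENNReal.ofReal (Real.log M ^ 3) +
          ∑' k : ℕ, {y | ‖f y‖ ≤ Real.exp (-k)}.indicator
            (fun _ => ENNReal.ofReal ((k + 1) ^ 3)) y) :=
        lintegral_mono fun y => enorm_log_pow_three_le (norm_nonneg _) (hM y)
    _ = ENNReal.ofReal (Real.log M ^ 3) * ENNReal.ofReal l + ∑' k : ℕ,
          ENNReal.ofReal ((k + 1) ^ 3) *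
            volume (Set.Icc x (x + l) ∩ {y | ‖f y‖ ≤ Real.exp (-k)}) := by
        rw [lintegral_add_left measurable_const, lintegral_tsum fun k =>
          (measurable_const.indicator (hmeas k)).aemeasurable]
        simp only [lintegral_const, Measure.restrict_apply_univ, Real.volume_Icc,
          add_sub_cancel_left]
        congr 1
        refine tsum_congr fun k => ?_
        rw [lintegral_indicator_const (hmeas k), Measure.restrict_apply (hmeas k), Set.inter_comm]
    _ ≤ _ := by
        gcongr with k
        exact H x _ (Real.exp_pos _)

lemma lintegral_Icc_le_of_window {g : ℝ → ℝ≥0∞} {l : ℝ} (hl : 0 < l) {B : ℝ≥0∞}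
    (hB : ∀ x : ℝ, ∫⁻ y in Set.Icc x (x + l), g y ≤ B) {L : ℝ} (hL : 1 ≤ L) :
    ∫⁻ y in Set.Icc (-L) L, g y ≤ B * ENNReal.ofReal (1 / l + 1) * ENNReal.ofReal (2 * L) := by
  -- `N + 1` windows cover the interval; the extra one is absorbed using `1 ≤ 2 * L`.
  set N : ℕ := ⌊2 * L / l⌋₊ with hN
  have hN1 : (N : ℝ) ≤ 2 * L / l := Nat.floor_le (by positivity)
  have hsub : Set.Icc (-L) L ⊆ ⋃ k : Fin (N + 1), Set.Icc (-L + k * l) (-L + k * l + l) := by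
    intro y hy
    have hy0 : 0 ≤ (y + L) / l := div_nonneg (by linarith [hy.1]) hl.le
    have h1 := Nat.floor_le hy0
    have h2 := Nat.lt_floor_add_one ((y + L) / l)
    rw [le_div_iff₀ hl] at h1
    rw [div_lt_iff₀ hl] at h2
    have h3 : ⌊(y + L) / l⌋₊ ≤ N := Nat.floor_mono (by gcongr; linarith [hy.2])
    exact Set.mem_iUnion.2 ⟨⟨⌊(y + L) / l⌋₊, by omega⟩, by simp; linarith, by simp; linarith⟩
  calc ∫⁻ y in Set.Icc (-L) L, g y
      ≤ ∫⁻ y in ⋃ k : Fin (N + 1), Set.Icc (-L + k * l) (-L + k * l + l), g y :=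
        lintegral_mono_set hsub
    _ ≤ ∑' k : Fin (N + 1), ∫⁻ y in Set.Icc (-L + k * l) (-L + k * l + l), g y :=
        lintegral_iUnion_le _ _
    _ ≤ ∑' _ : Fin (N + 1), B := ENNReal.tsum_le_tsum fun k => hB _
    _ = B * ENNReal.ofReal (N + 1) := by
        rw [tsum_fintype, Finset.sum_const, Finset.card_univ, Fintype.card_fin, nsmul_eq_mul,
          mul_comm, ← Nat.cast_succ, ENNReal.ofReal_natCast]
    _ ≤ _ := by
        rw [mul_assoc, ← ENNReal.ofReal_mul (by positivity)]
        gcongr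
        have : (1 / l + 1) * (2 * L) = 2 * L / l + 2 * L := by ring
        linarith

/-- The mean cube of the logarithm of a nonzero exponential sum is bounded. -/
lemma exists_lintegral_log_expSum_le {ι : Type*} [Fintype ι] {c : ι → ℂ} {τ : ι → ℝ}
    (hτ : Function.Injective τ) {i : ι} (hi : c i ≠ 0) :
    ∃ B : ℝ, 0 ≤ B ∧ ∀ L : ℝ, 1 ≤ L → ∫⁻ y in Set.Icc (-L) L, ‖Real.log ‖expSum c τ y‖‖ₑ ^ 3 ≤
      ENNReal.ofReal (B * (2 * L)) := by
  obtain ⟨l, hl, C, hC, α, hα, H⟩ := exists_volume_expSum_le hτ hi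
  obtain ⟨B, hB, HB⟩ := exists_lintegral_window_le (continuous_expSum c τ) (norm_expSum_le c τ)
    hC hα H
  have hB' : B * ENNReal.ofReal (1 / l + 1) ≠ ⊤ := ENNReal.mul_ne_top hB ENNReal.ofReal_ne_top
  refine ⟨_, ENNReal.toReal_nonneg (a := B * ENNReal.ofReal (1 / l + 1)), fun L hL => ?_⟩
  rw [ENNReal.ofReal_mul ENNReal.toReal_nonneg, ENNReal.ofReal_toReal hB']
  exact lintegral_Icc_le_of_window hl HB hL

/-! ### Equidistribution of lines on the torus -/

/-- The quotient map `ℝᵈ → (ℝ/ℤ)ᵈ`. -/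
def torusMk {d : ℕ} (t : Fin d → ℝ) : UnitAddTorus (Fin d) := fun i => (t i : UnitAddCircle)

@[fun_prop]
lemma continuous_torusMk {d : ℕ} : Continuous (torusMk (d := d)) :=
  continuous_pi fun i => (AddCircle.continuous_mk' 1).comp (continuous_apply i)

lemma mFourier_torusMk {d : ℕ} (n : Fin d → ℤ) (t : Fin d → ℝ) :
    UnitAddTorus.mFourier n (torusMk t) = ∏ i, expChar (n i * t i) := by
  simp only [UnitAddTorus.mFourier, torusMk, ContinuousMap.coe_mk, fourier_coe_apply, expChar]
  refine Finset.prod_congr rfl fun i _ => ?_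
  congr 1
  push_cast
  ring

lemma mFourier_torusMk_mul {d : ℕ} (n : Fin d → ℤ) (r : Fin d → ℝ) (y : ℝ) :
    UnitAddTorus.mFourier n (torusMk fun i => r i * y) = expChar ((∑ i, n i * r i) * y) := by
  rw [mFourier_torusMk, Finset.sum_mul, expChar_sum]
  simp only [mul_assoc]

lemma intervalIntegral_expChar_mul {w : ℝ} (hw : w ≠ 0) (a b : ℝ) :
    ∫ y in a..b, expChar (w * y) =
      (expChar (w * b) - expChar (w * a)) / (2 * Real.pi * Complex.I * w) := by
  have hw' : (2 * Real.pi * Complex.I * w : ℂ) ≠ 0 := by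
    simp [hw, Real.pi_ne_zero, Complex.I_ne_zero]
  have h := integral_exp_mul_complex (a := a) (b := b) hw'
  simpa only [expChar, Complex.ofReal_mul, mul_assoc] using h

lemma tendsto_mean_expChar (w : ℝ) :
    Tendsto (fun L : ℝ => (1 / (2 * L)) • ∫ y in (-L)..L, expChar (w * y)) atTop
      (𝓝 (if w = 0 then 1 else 0)) := by
  split_ifs with hw
  · refine tendsto_const_nhds.congr' ?_
    filter_upwards [eventually_gt_atTop 0] with L hL
    simp only [hw, zero_mul, expChar_zero, intervalIntegral.integral_const, smul_smul]
    rw [show 1 / (2 * L) * (L - -L) = 1 by field_simp; ring, one_smul]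
  · have h0 : Tendsto (fun L : ℝ => 1 / (2 * L) * (2 / ‖(2 * Real.pi * Complex.I * w : ℂ)‖)) atTop
        (𝓝 0) := by
      have : Tendsto (fun L : ℝ => 1 / (2 * L)) atTop (𝓝 0) :=
        tendsto_const_nhds.div_atTop (tendsto_id.const_mul_atTop two_pos)
      simpa using this.mul_const _
    refine squeeze_zero_norm' ?_ h0
    filter_upwards [eventually_gt_atTop 0] with L hL
    rw [norm_smul, Real.norm_of_nonneg (by positivity), intervalIntegral_expChar_mul hw, norm_div]
    have := norm_sub_le (expChar (w * L)) (expChar (w * -L))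
    rw [norm_expChar, norm_expChar, one_add_one_eq_two] at this
    gcongr

lemma volume_restrict_Icc_pi (d : ℕ) : (volume : Measure (Fin d → ℝ)).restrict (Set.Icc 0 1) =
    Measure.pi fun _ => (volume : Measure ℝ).restrict (Set.Icc 0 1) := by
  rw [volume_pi, ← Measure.restrict_pi_pi, Set.pi_univ_Icc]
  rfl

instance isProbabilityMeasure_restrict_Icc (d : ℕ) :
    IsProbabilityMeasure ((volume : Measure (Fin d → ℝ)).restrict (Set.Icc 0 1)) := by
  have : IsProbabilityMeasure ((volume : Measure ℝ).restrict (Set.Icc 0 1)) := ⟨by simp⟩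
  rw [volume_restrict_Icc_pi]
  infer_instance

lemma integral_Icc_expChar_int_mul (n : ℤ) :
    ∫ x in Set.Icc (0 : ℝ) 1, expChar (n * x) = if n = 0 then 1 else 0 := by
  split_ifs with hn
  · simp [hn, expChar_zero]
  · rw [integral_Icc_eq_integral_Ioc, ← intervalIntegral.integral_of_le zero_le_one,
      intervalIntegral_expChar_mul (by exact_mod_cast hn), ← expChar_zpow]
    have : expChar 1 = 1 := by simp [expChar, Complex.exp_two_pi_mul_I]
    simp [this, expChar_zero]

lemma integral_Icc_mFourier {d : ℕ} (n : Fin d → ℤ) :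
    ∫ t in Set.Icc (0 : Fin d → ℝ) 1, UnitAddTorus.mFourier n (torusMk t) =
      if n = 0 then 1 else 0 := by
  simp_rw [mFourier_torusMk]
  rw [volume_restrict_Icc_pi,
    integral_fintype_prod_eq_prod (𝕜 := ℂ) (fun i (x : ℝ) => expChar (n i * x))]
  simp_rw [integral_Icc_expChar_int_mul]
  split_ifs with h
  · simp [h]
  · obtain ⟨i, hi⟩ := Function.ne_iff.1 h
    exact Finset.prod_eq_zero (Finset.mem_univ i) (if_neg hi)

/-- Rational independence enters here: a nontrivial character of the torus has nonzero frequency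
along the line, hence mean value `0`. -/
lemma sum_int_mul_eq_zero_iff {d : ℕ} {r : Fin d → ℝ} (hr : LinearIndependent ℚ r)
    (n : Fin d → ℤ) : ∑ i, n i * r i = 0 ↔ n = 0 := by
  refine ⟨fun h => funext fun i => ?_, fun h => by simp [h]⟩
  have := Fintype.linearIndependent_iff.1 hr (fun i => (n i : ℚ))
    (by simpa [Rat.smul_def] using h) i
  exact_mod_cast this

lemma tendsto_of_forall_approx {E : Type*} [PseudoMetricSpace E] {f : ℝ → E} {a : E}
    (h : ∀ ε > 0, ∃ (g : ℝ → E) (b : E), Tendsto g atTop (𝓝 b) ∧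
      (∀ᶠ L in atTop, dist (f L) (g L) ≤ ε) ∧ dist b a ≤ ε) : Tendsto f atTop (𝓝 a) := by
  rw [Metric.tendsto_nhds]
  intro ε hε
  obtain ⟨g, b, hg, hfg, hba⟩ := h (ε / 3) (by positivity)
  filter_upwards [hfg, Metric.tendsto_nhds.1 hg (ε / 3) (by positivity)] with L h1 h2
  linarith [dist_triangle4 (f L) (g L) b a]

lemma dist_mean_le {f g : ℝ → ℂ} (hf : Continuous f) (hg : Continuous g) {ε : ℝ}
    (h : ∀ y, ‖f y - g y‖ ≤ ε) {L : ℝ} (hL : 0 < L) :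
    dist ((1 / (2 * L)) • ∫ y in (-L)..L, f y) ((1 / (2 * L)) • ∫ y in (-L)..L, g y) ≤ ε := by
  rw [dist_eq_norm, ← smul_sub, ← intervalIntegral.integral_sub (hf.intervalIntegrable _ _)
    (hg.intervalIntegrable _ _), norm_smul, Real.norm_of_nonneg (by positivity)]
  have := intervalIntegral.norm_integral_le_of_norm_le_const (a := -L) (b := L)
    (f := fun y => f y - g y) (C := ε) fun y _ => h y
  calc _ ≤ 1 / (2 * L) * (ε * |L - -L|) := by gcongr
    _ = ε := by
      rw [abs_of_pos (by linarith)]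
      field_simp
      ring

/-- Weyl's equidistribution theorem for lines with rationally independent slopes. -/
theorem tendsto_mean_torusMk {d : ℕ} {r : Fin d → ℝ} (hr : LinearIndependent ℚ r)
    (G : C(UnitAddTorus (Fin d), ℂ)) :
    Tendsto (fun L : ℝ => (1 / (2 * L)) • ∫ y in (-L)..L, G (torusMk fun i => r i * y)) atTop
      (𝓝 (∫ t in Set.Icc (0 : Fin d → ℝ) 1, G (torusMk t))) := by
  have hline : ∀ q : C(UnitAddTorus (Fin d), ℂ), Continuous fun y : ℝ =>
      q (torusMk fun i => r i * y) := fun q => by fun_prop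
  have hint : ∀ q : C(UnitAddTorus (Fin d), ℂ),
      IntegrableOn (fun t => q (torusMk t)) (Set.Icc (0 : Fin d → ℝ) 1) := fun q =>
    (q.continuous.comp continuous_torusMk).continuousOn.integrableOn_compact isCompact_Icc
  -- On trigonometric polynomials the claim is linear and reduces to single characters; uniform
  -- density then handles `G`.
  have hspan : ∀ q ∈ Submodule.span ℂ (Set.range (UnitAddTorus.mFourier (d := Fin d))),
      Tendsto (fun L : ℝ => (1 / (2 * L)) • ∫ y in (-L)..L, q (torusMk fun i => r i * y)) atTop
      (𝓝 (∫ t in Set.Icc (0 : Fin d → ℝ) 1, q (torusMk t))) := by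
    intro q hq
    induction hq using Submodule.span_induction with
    | mem q hq =>
      obtain ⟨n, rfl⟩ := hq
      simp_rw [mFourier_torusMk_mul]
      rw [integral_Icc_mFourier]
      simpa only [sum_int_mul_eq_zero_iff hr n] using tendsto_mean_expChar (∑ i, n i * r i)
    | zero => simp
    | add p q _ _ hp hq =>
      simp only [ContinuousMap.add_apply]
      rw [integral_add (hint p) (hint q)]
      refine (hp.add hq).congr fun L => ?_
      rw [intervalIntegral.integral_add ((hline p).intervalIntegrable _ _)
        ((hline q).intervalIntegrable _ _), smul_add]
    | smul c q _ hq =>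
      simp only [ContinuousMap.smul_apply]
      rw [integral_smul]
      refine (hq.const_smul c).congr fun L => ?_
      rw [intervalIntegral.integral_smul, smul_comm]
  refine tendsto_of_forall_approx fun ε hε => ?_
  have hG : G ∈ closure (Submodule.span ℂ (Set.range (UnitAddTorus.mFourier (d := Fin d))) :
      Set C(UnitAddTorus (Fin d), ℂ)) := by
    rw [← Submodule.topologicalClosure_coe, UnitAddTorus.span_mFourier_closure_eq_top]
    trivial
  obtain ⟨q, hq, hGq⟩ := Metric.mem_closure_iff.1 hG ε hε
  have hpt : ∀ z, ‖G z - q z‖ ≤ ε := fun z => by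
    rw [← dist_eq_norm]
    exact (ContinuousMap.dist_apply_le_dist z).trans hGq.le
  refine ⟨_, _, hspan q hq, ?_, ?_⟩
  · filter_upwards [eventually_gt_atTop 0] with L hL
    exact dist_mean_le (hline G) (hline q) (fun y => hpt _) hL
  · rw [dist_eq_norm, ← integral_sub (hint q) (hint G)]
    refine (norm_integral_le_of_norm_le_const (C := ε) (.of_forall fun t => ?_)).trans ?_
    · rw [norm_sub_rev]
      exact hpt _
    · simp

/-! ### Truncated logarithms -/

/-- The logarithm truncated below at height `-k`. -/
def truncLog (k : ℕ) (u : ℝ) : ℝ := Real.log (max u (Real.exp (-k)))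

@[fun_prop]
lemma continuous_truncLog (k : ℕ) : Continuous (truncLog k) :=
  Continuous.log (by fun_prop) fun _ => (lt_max_of_lt_right (Real.exp_pos _)).ne'

lemma truncLog_zero (k : ℕ) : truncLog k 0 = -k := by
  rw [truncLog, max_eq_right (Real.exp_pos _).le, Real.log_exp]

lemma truncLog_of_le {k : ℕ} {u : ℝ} (h : Real.exp (-k) ≤ u) : truncLog k u = Real.log u := by
  rw [truncLog, max_eq_left h]

lemma truncLog_of_lt {k : ℕ} {u : ℝ} (h : u < Real.exp (-k)) : truncLog k u = -k := by
  rw [truncLog, max_eq_right h.le, Real.log_exp]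

lemma log_lt_of_lt_exp {k : ℕ} {u : ℝ} (hu : 0 < u) (h : u < Real.exp (-k)) :
    Real.log u < -k := (Real.log_lt_iff_lt_exp hu).2 h

lemma abs_truncLog_le {k : ℕ} {u : ℝ} (hu : 0 < u) : |truncLog k u| ≤ |Real.log u| := by
  rcases le_or_gt (Real.exp (-k)) u with h | h
  · rw [truncLog_of_le h]
  · have h1 := log_lt_of_lt_exp hu h
    have hk : (0 : ℝ) ≤ k := k.cast_nonneg
    rw [truncLog_of_lt h, abs_neg, abs_of_nonneg hk, abs_of_nonpos (by linarith)]
    linarith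

/-- Where truncation acts, `|log u|` exceeds both `k` and the error, so spare powers of `|log u|`
buy powers of `1 / k`. The choice `(m, n) = (0, 2)` serves the mean value and `(1, 1)` the mean
square. -/
lemma pow_mul_abs_log_sub_truncLog_pow_le (m n : ℕ) {k : ℕ} {u : ℝ} (hu : 0 < u) :
    (k : ℝ) ^ n * |Real.log u - truncLog k u| ^ (m + 1) ≤ |Real.log u| ^ (m + 1 + n) := by
  rcases le_or_gt (Real.exp (-k)) u with h | h
  · rw [truncLog_of_le h]
    simp
  · have h1 := log_lt_of_lt_exp hu h
    have hk : (0 : ℝ) ≤ k := k.cast_nonneg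
    rw [truncLog_of_lt h, pow_add _ (m + 1), mul_comm,
      abs_of_nonpos (show Real.log u ≤ 0 by linarith),
      abs_of_nonpos (show Real.log u - -k ≤ 0 by linarith)]
    exact mul_le_mul (pow_le_pow_left₀ (by linarith) (by linarith) _)
      (pow_le_pow_left₀ hk (by linarith) _) (by positivity) (pow_nonneg (by linarith) _)

lemma eventually_truncLog_eq {u : ℝ} (hu : 0 < u) : ∀ᶠ k in atTop, truncLog k u = Real.log u := by
  have h : Tendsto (fun k : ℕ => Real.exp (-k)) atTop (𝓝 0) :=
    Real.tendsto_exp_neg_atTop_nhds_zero.comp tendsto_natCast_atTop_atTop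
  filter_upwards [h.eventually_le_const hu] with k hk
  exact truncLog_of_le hk

/-- The truncated logarithm of the modulus of a continuous function. -/
def truncLogNorm {X : Type*} [TopologicalSpace X] (k : ℕ) (F : C(X, ℂ)) : C(X, ℝ) :=
  ⟨fun z => truncLog k ‖F z‖, by fun_prop⟩

lemma truncLogNorm_apply {X : Type*} [TopologicalSpace X] (k : ℕ) (F : C(X, ℂ)) (z : X) :
    truncLogNorm k F z = truncLog k ‖F z‖ := rfl

/-! ### The mean value of the logarithm -/

lemma tendsto_mean_torusMk_real {d : ℕ} {r : Fin d → ℝ} (hr : LinearIndependent ℚ r)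
    (G : C(UnitAddTorus (Fin d), ℝ)) :
    Tendsto (fun L : ℝ => 1 / (2 * L) * ∫ y in (-L)..L, G (torusMk fun i => r i * y)) atTop
      (𝓝 (∫ t in Set.Icc (0 : Fin d → ℝ) 1, G (torusMk t))) := by
  have h := tendsto_mean_torusMk hr (⟨fun z => (G z : ℂ), by fun_prop⟩ : C(UnitAddTorus (Fin d), ℂ))
  simp only [ContinuousMap.coe_mk, intervalIntegral.integral_ofReal, integral_complex_ofReal] at h
  have h2 := (Complex.continuous_re.tendsto _).comp h
  simpa [Function.comp_def] using h2

lemma memLp_log_norm {f : ℝ → ℂ} (hf : Continuous f) {B : ℝ}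
    (hB : ∀ L : ℝ, 1 ≤ L → ∫⁻ y in Set.Icc (-L) L, ‖Real.log ‖f y‖‖ₑ ^ 3 ≤
      ENNReal.ofReal (B * (2 * L))) (L : ℝ) :
    MemLp (fun y => Real.log ‖f y‖) 2 (volume.restrict (Set.Icc (-L) L)) := by
  -- The radius is raised to `max L 1` because the cube bound is available only from `1` on.
  have h3 : MemLp (fun y => Real.log ‖f y‖) 3 (volume.restrict (Set.Icc (-max L 1) (max L 1))) := by
    refine ⟨(Real.measurable_log.comp hf.norm.measurable).aestronglyMeasurable, ?_⟩
    rw [eLpNorm_lt_top_iff_lintegral_rpow_enorm_lt_top (by norm_num) (by norm_num)]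
    have := (hB _ (le_max_right L 1)).trans_lt ENNReal.ofReal_lt_top
    simpa using this
  refine (h3.mono_exponent (by norm_num)).mono_measure (Measure.restrict_mono ?_ le_rfl)
  exact Set.Icc_subset_Icc (neg_le_neg (le_max_left _ _)) (le_max_left _ _)

/-- The truncation error of the logarithm is small in the mean. -/
lemma lintegral_log_sub_truncLog_le {f : ℝ → ℂ} (hf0 : ∀ᵐ y, f y ≠ 0) {B : ℝ}
    (hB : ∀ L : ℝ, 1 ≤ L → ∫⁻ y in Set.Icc (-L) L, ‖Real.log ‖f y‖‖ₑ ^ 3 ≤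
      ENNReal.ofReal (B * (2 * L))) {m n : ℕ} (hmn : m + 1 + n = 3) {k : ℕ} (hk : 0 < k) {L : ℝ}
    (hL : 1 ≤ L) :
    ∫⁻ y in Set.Icc (-L) L, ‖Real.log ‖f y‖ - truncLog k ‖f y‖‖ₑ ^ (m + 1) ≤
      ENNReal.ofReal (B / k ^ n * (2 * L)) := by
  have hk' : (0 : ℝ) < k ^ n := by positivity
  calc _ ≤ ∫⁻ y in Set.Icc (-L) L, ENNReal.ofReal (1 / k ^ n) * ‖Real.log ‖f y‖‖ₑ ^ 3 := by
        refine lintegral_mono_ae (ae_restrict_of_ae ?_)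
        filter_upwards [hf0] with y hy
        have := pow_mul_abs_log_sub_truncLog_pow_le m n (k := k) (norm_pos_iff.2 hy)
        rw [hmn] at this
        rw [Real.enorm_eq_ofReal_abs, Real.enorm_eq_ofReal_abs, ← ENNReal.ofReal_pow (abs_nonneg _),
          ← ENNReal.ofReal_pow (abs_nonneg _), ← ENNReal.ofReal_mul (by positivity)]
        refine ENNReal.ofReal_le_ofReal ?_
        rw [one_div_mul_eq_div, le_div_iff₀ hk', mul_comm]
        exact this
    _ = ENNReal.ofReal (1 / k ^ n) * ∫⁻ y in Set.Icc (-L) L, ‖Real.log ‖f y‖‖ₑ ^ 3 :=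
        lintegral_const_mul' _ _ ENNReal.ofReal_ne_top
    _ ≤ ENNReal.ofReal (1 / k ^ n) * ENNReal.ofReal (B * (2 * L)) := by gcongr; exact hB L hL
    _ = _ := by
        rw [← ENNReal.ofReal_mul (by positivity)]
        ring_nf

lemma abs_intervalIntegral_le_of_lintegral_le {g : ℝ → ℝ} {K L : ℝ} (hL : 0 ≤ L) (hK : 0 ≤ K)
    (h : ∫⁻ y in Set.Icc (-L) L, ‖g y‖ₑ ≤ ENNReal.ofReal K) : |∫ y in (-L)..L, g y| ≤ K := by
  rw [intervalIntegral.integral_of_le (by linarith), ← integral_Icc_eq_integral_Ioc]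
  have h1 := (enorm_integral_le_lintegral_enorm g).trans h
  rwa [Real.enorm_eq_ofReal_abs, ENNReal.ofReal_le_ofReal_iff hK] at h1

lemma dist_mean_log_mean_truncLog_le {f : ℝ → ℂ} (hf : Continuous f) (hf0 : ∀ᵐ y, f y ≠ 0) {B : ℝ}
    (hB0 : 0 ≤ B) (hB : ∀ L : ℝ, 1 ≤ L → ∫⁻ y in Set.Icc (-L) L, ‖Real.log ‖f y‖‖ₑ ^ 3 ≤
      ENNReal.ofReal (B * (2 * L))) {k : ℕ} (hk : 0 < k) {L : ℝ} (hL : 1 ≤ L) :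
    dist (1 / (2 * L) * ∫ y in (-L)..L, Real.log ‖f y‖)
      (1 / (2 * L) * ∫ y in (-L)..L, truncLog k ‖f y‖) ≤ B / k ^ 2 := by
  have hi : IntervalIntegrable (fun y => Real.log ‖f y‖) volume (-L) L := by
    rw [intervalIntegrable_iff_integrableOn_Icc_of_le (by linarith)]
    exact (memLp_log_norm hf hB L).integrable (by norm_num)
  have hi' : IntervalIntegrable (fun y => truncLog k ‖f y‖) volume (-L) L :=
    Continuous.intervalIntegrable (by fun_prop) _ _
  have h1 := lintegral_log_sub_truncLog_le hf0 hB (m := 0) (n := 2) rfl hk hL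
  simp only [zero_add, pow_one] at h1
  have h2 := abs_intervalIntegral_le_of_lintegral_le (by linarith) (by positivity) h1
  rw [Real.dist_eq, ← mul_sub, ← intervalIntegral.integral_sub hi hi', abs_mul,
    abs_of_pos (by positivity)]
  calc _ ≤ 1 / (2 * L) * (B / k ^ 2 * (2 * L)) := by gcongr
    _ = _ := by field_simp

/-- The torus integrals of the truncated logarithms are bounded. -/
lemma lintegral_truncLogNorm_torusMk_le {d : ℕ} {r : Fin d → ℝ} (hr : LinearIndependent ℚ r)
    {f : ℝ → ℂ} (hf0 : ∀ᵐ y, f y ≠ 0) {B : ℝ}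
    (hB0 : 0 ≤ B) (hB : ∀ L : ℝ, 1 ≤ L → ∫⁻ y in Set.Icc (-L) L, ‖Real.log ‖f y‖‖ₑ ^ 3 ≤
      ENNReal.ofReal (B * (2 * L))) (F : C(UnitAddTorus (Fin d), ℂ))
    (hF : ∀ y, f y = F (torusMk fun i => r i * y)) (k : ℕ) :
    ∫⁻ t in Set.Icc (0 : Fin d → ℝ) 1, ‖truncLog k ‖F (torusMk t)‖‖ₑ ≤ ENNReal.ofReal (1 + B) := by
  have hlim := tendsto_mean_torusMk_real hr |truncLogNorm k F|
  -- By Weyl the torus integral is a limit of means along the line, where `|truncLog| ≤ |log| ≤ 1 +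
  -- |log| ^ 3`.
  have hle : ∫ t in Set.Icc (0 : Fin d → ℝ) 1, |truncLogNorm k F| (torusMk t) ≤ 1 + B := by
    refine le_of_tendsto hlim ?_
    filter_upwards [eventually_ge_atTop 1] with L hL
    have h1 : ∫⁻ y in Set.Icc (-L) L, ‖|truncLog k ‖f y‖|‖ₑ ≤
        ENNReal.ofReal ((1 + B) * (2 * L)) := by
      calc _ ≤ ∫⁻ y in Set.Icc (-L) L, (1 + ‖Real.log ‖f y‖‖ₑ ^ 3) := by
            refine lintegral_mono_ae (ae_restrict_of_ae ?_)
            filter_upwards [hf0] with y hy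
            have h2 := abs_truncLog_le (k := k) (norm_pos_iff.2 hy)
            rw [Real.enorm_abs, Real.enorm_eq_ofReal_abs, Real.enorm_eq_ofReal_abs,
              ← ENNReal.ofReal_pow (abs_nonneg _), ← ENNReal.ofReal_one,
              ← ENNReal.ofReal_add zero_le_one (by positivity)]
            refine ENNReal.ofReal_le_ofReal (h2.trans ?_)
            rcases le_total |Real.log ‖f y‖| 1 with h | h
            · linarith [pow_nonneg (abs_nonneg (Real.log ‖f y‖)) 3]
            · linarith [le_self_pow₀ h (show 3 ≠ 0 by norm_num)]
        _ ≤ ENNReal.ofReal (2 * L) + ENNReal.ofReal (B * (2 * L)) := by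
            rw [lintegral_add_left measurable_const]
            refine add_le_add (le_of_eq ?_) (hB L hL)
            simp only [lintegral_const, Measure.restrict_apply_univ, Real.volume_Icc, one_mul]
            ring_nf
        _ = _ := by
            rw [← ENNReal.ofReal_add (by positivity) (by positivity)]
            ring_nf
    have h2 := abs_intervalIntegral_le_of_lintegral_le (by linarith) (by positivity) h1
    simp only [ContinuousMap.abs_apply, truncLogNorm_apply, ← hF]
    calc _ ≤ 1 / (2 * L) * ((1 + B) * (2 * L)) := by
          gcongr
          exact (le_abs_self _).trans h2
      _ = _ := by field_simp
  rw [← ofReal_integral_norm_eq_lintegral_enorm]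
  · exact ENNReal.ofReal_le_ofReal hle
  · exact ContinuousOn.integrableOn_compact isCompact_Icc (Continuous.continuousOn (by fun_prop))

/-- The mean value of `log |f|`, for `f` the restriction of a continuous function on the torus to a
line with rationally independent slopes, is the integral over the torus, provided that the mean of
`|log |f|| ^ 3` is bounded. -/
theorem integrableOn_and_tendsto_mean_log {d : ℕ} {r : Fin d → ℝ} (hr : LinearIndependent ℚ r)
    {f : ℝ → ℂ} (hf : Continuous f) (hf0 : ∀ᵐ y, f y ≠ 0) {B : ℝ}
    (hB0 : 0 ≤ B) (hB : ∀ L : ℝ, 1 ≤ L → ∫⁻ y in Set.Icc (-L) L, ‖Real.log ‖f y‖‖ₑ ^ 3 ≤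
      ENNReal.ofReal (B * (2 * L))) (F : C(UnitAddTorus (Fin d), ℂ))
    (hF : ∀ y, f y = F (torusMk fun i => r i * y)) :
    IntegrableOn (fun t => Real.log ‖F (torusMk t)‖) (Set.Icc (0 : Fin d → ℝ) 1) ∧
      Tendsto (fun L : ℝ => 1 / (2 * L) * ∫ y in (-L)..L, Real.log ‖f y‖) atTop
        (𝓝 (∫ t in Set.Icc (0 : Fin d → ℝ) 1, Real.log ‖F (torusMk t)‖)) := by
  set μ : Measure (Fin d → ℝ) := volume.restrict (Set.Icc 0 1) with hμ
  have hbd := lintegral_truncLogNorm_torusMk_le hr hf0 hB0 hB F hF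
  have hm : ∀ k : ℕ, Continuous fun t => truncLog k ‖F (torusMk t)‖ := fun k => by fun_prop
  have hnull : ∀ᵐ t ∂μ, F (torusMk t) ≠ 0 := by
    -- The truncated logarithm equals `-k` on the zero set, so Markov's inequality bounds `k` times
    -- its measure independently of `k`.
    have h1 : ∀ k : ℕ, (k : ℝ≥0∞) * μ {t | F (torusMk t) = 0} ≤ ENNReal.ofReal (1 + B) := by
      intro k
      refine le_trans ?_ ((mul_meas_ge_le_lintegral (μ := μ) (hm k).measurable.enorm k).trans
        (hbd k))
      gcongr
      intro ht
      rw [ht, norm_zero, truncLog_zero, enorm_neg, Real.enorm_natCast]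
    by_contra hne
    have h2 : μ {t | F (torusMk t) = 0} ≠ 0 := by
      simpa [ae_iff] using hne
    obtain ⟨k, hk⟩ := ENNReal.exists_nat_mul_gt h2 (b := ENNReal.ofReal (1 + B))
      ENNReal.ofReal_ne_top
    exact absurd (h1 k) (not_le.2 hk)
  have hlim : ∀ᵐ t ∂μ, Tendsto (fun k => truncLog k ‖F (torusMk t)‖) atTop
      (𝓝 (Real.log ‖F (torusMk t)‖)) := by
    filter_upwards [hnull] with t ht
    exact tendsto_const_nhds.congr'
      ((eventually_truncLog_eq (norm_pos_iff.2 ht)).mono fun k hk => hk.symm)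
  have hint : Integrable (fun t => Real.log ‖F (torusMk t)‖) μ := by
    refine ⟨aestronglyMeasurable_of_tendsto_ae _ (fun k => (hm k).aestronglyMeasurable) hlim, ?_⟩
    refine hasFiniteIntegral_iff_enorm.2 (lt_of_le_of_lt ?_
      (ENNReal.ofReal_lt_top (r := 1 + B)))
    calc ∫⁻ t, ‖Real.log ‖F (torusMk t)‖‖ₑ ∂μ
        = ∫⁻ t, liminf (fun k => ‖truncLog k ‖F (torusMk t)‖‖ₑ) atTop ∂μ :=
          lintegral_congr_ae (hlim.mono fun t ht => ht.enorm.liminf_eq.symm)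
      _ ≤ liminf (fun k => ∫⁻ t, ‖truncLog k ‖F (torusMk t)‖‖ₑ ∂μ) atTop :=
          lintegral_liminf_le fun k => (hm k).measurable.enorm
      _ ≤ _ := liminf_le_of_le (by isBoundedDefault) fun b hb => by
          obtain ⟨k, hk⟩ := hb.exists
          exact hk.trans (hbd k)
  refine ⟨hint, tendsto_of_forall_approx fun ε hε => ?_⟩
  have hdom : Tendsto (fun k => ∫ t, truncLog k ‖F (torusMk t)‖ ∂μ) atTop
      (𝓝 (∫ t, Real.log ‖F (torusMk t)‖ ∂μ)) := by
    refine tendsto_integral_of_dominated_convergence (fun t => |Real.log ‖F (torusMk t)‖|)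
      (fun k => (hm k).aestronglyMeasurable) hint.abs (fun k => ?_) hlim
    filter_upwards [hnull] with t ht
    exact abs_truncLog_le (norm_pos_iff.2 ht)
  have hBk : Tendsto (fun k : ℕ => B / (k : ℝ) ^ 2) atTop (𝓝 0) :=
    tendsto_const_nhds.div_atTop
      ((tendsto_pow_atTop (by norm_num)).comp tendsto_natCast_atTop_atTop)
  -- One `k` makes the truncation error at most `ε` both on the torus and on the line, in the latter
  -- case for all `L ≥ 1` at once; only then does `L → ∞`.
  obtain ⟨k, hk1, hk2, hk0⟩ := ((Metric.tendsto_nhds.1 hdom ε hε).and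
    ((hBk.eventually_le_const hε).and (eventually_gt_atTop 0))).exists
  refine ⟨_, _, tendsto_mean_torusMk_real hr (truncLogNorm k F), ?_, hk1.le⟩
  filter_upwards [eventually_ge_atTop 1] with L hL
  simp only [truncLogNorm_apply, ← hF]
  exact (dist_mean_log_mean_truncLog_le hf hf0 hB0 hB hk0 hL).trans hk2

/-! ### Mean-square almost periodicity of the logarithm -/

lemma genTrigPoly_eq_sum (c : ℝ →₀ ℂ) (y : ℝ) :
    genTrigPoly c y = c.sum fun s a => a * expChar (s * y) := by
  simp only [genTrigPoly, Finsupp.sum, expChar, Complex.ofReal_mul]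

lemma genTrigPoly_add (c c' : ℝ →₀ ℂ) (y : ℝ) :
    genTrigPoly (c + c') y = genTrigPoly c y + genTrigPoly c' y := by
  simp only [genTrigPoly_eq_sum]
  exact Finsupp.sum_add_index' (by simp) (by simp [add_mul])

lemma genTrigPoly_smul (a : ℂ) (c : ℝ →₀ ℂ) (y : ℝ) :
    genTrigPoly (a • c) y = a * genTrigPoly c y := by
  simp only [genTrigPoly_eq_sum]
  rw [Finsupp.sum_smul_index (by simp), Finsupp.sum, Finsupp.sum, Finset.mul_sum]
  simp only [mul_assoc]

/-- A character of the torus restricts to a single exponential on the line, of frequency `∑ i, n i *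
r i`. -/
lemma exists_genTrigPoly_eq {d : ℕ} (r : Fin d → ℝ) {q : C(UnitAddTorus (Fin d), ℂ)}
    (hq : q ∈ Submodule.span ℂ (Set.range (UnitAddTorus.mFourier (d := Fin d)))) :
    ∃ c : ℝ →₀ ℂ, ∀ y, genTrigPoly c y = q (torusMk fun i => r i * y) := by
  induction hq using Submodule.span_induction with
  | mem q hq =>
    obtain ⟨n, rfl⟩ := hq
    refine ⟨Finsupp.single (∑ i, n i * r i) 1, fun y => ?_⟩
    rw [mFourier_torusMk_mul, genTrigPoly_eq_sum, Finsupp.sum_single_index (by simp), one_mul]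
  | zero => exact ⟨0, fun y => by simp [genTrigPoly]⟩
  | add p q _ _ hp hq =>
    obtain ⟨c, hc⟩ := hp
    obtain ⟨c', hc'⟩ := hq
    exact ⟨c + c', fun y => by rw [genTrigPoly_add, hc, hc', ContinuousMap.add_apply]⟩
  | smul a q _ hq =>
    obtain ⟨c, hc⟩ := hq
    exact ⟨a • c, fun y => by rw [genTrigPoly_smul, hc, ContinuousMap.smul_apply, smul_eq_mul]⟩

lemma besicovitchSq_le_of_forall {g : ℝ → ℂ} {K : ℝ≥0∞}
    (h : ∀ L : ℝ, 1 ≤ L → ∫⁻ y in Set.Icc (-L) L, ‖g y‖ₑ ^ 2 ≤ K * ENNReal.ofReal (2 * L)) :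
    besicovitchSq g ≤ K := by
  refine limsup_le_of_le (by isBoundedDefault) ?_
  filter_upwards [eventually_ge_atTop 1] with L hL
  exact ENNReal.div_le_of_le_mul (h L hL)

lemma lintegral_log_sub_le {f Q : ℝ → ℂ} (hf0 : ∀ᵐ y, f y ≠ 0) {B : ℝ} (hB0 : 0 ≤ B)
    (hB : ∀ L : ℝ, 1 ≤ L → ∫⁻ y in Set.Icc (-L) L, ‖Real.log ‖f y‖‖ₑ ^ 3 ≤
      ENNReal.ofReal (B * (2 * L))) {k : ℕ} (hk : 0 < k) {ε : ℝ}
    (hQ : ∀ y, ‖(truncLog k ‖f y‖ : ℂ) - Q y‖ ≤ ε) {L : ℝ} (hL : 1 ≤ L) :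
    ∫⁻ y in Set.Icc (-L) L, ‖((Real.log ‖f y‖ : ℝ) : ℂ) - Q y‖ₑ ^ 2 ≤
      ENNReal.ofReal (2 * (B / k) + 2 * ε ^ 2) * ENNReal.ofReal (2 * L) := by
  have h1 := lintegral_log_sub_truncLog_le hf0 hB (m := 1) (n := 1) rfl hk hL
  simp only [one_add_one_eq_two, pow_one] at h1
  calc _ ≤ ∫⁻ y in Set.Icc (-L) L, (ENNReal.ofReal (2 * ε ^ 2) +
          2 * ‖Real.log ‖f y‖ - truncLog k ‖f y‖‖ₑ ^ 2) := by
        refine lintegral_mono fun y => ?_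
        have h2 : ‖((Real.log ‖f y‖ : ℝ) : ℂ) - Q y‖ ≤
            |Real.log ‖f y‖ - truncLog k ‖f y‖| + ε := by
          have h3 := norm_add_le (((Real.log ‖f y‖ - truncLog k ‖f y‖ : ℝ) : ℂ))
            ((truncLog k ‖f y‖ : ℂ) - Q y)
          rw [Complex.norm_real, Real.norm_eq_abs, Complex.ofReal_sub, sub_add_sub_cancel] at h3
          linarith [hQ y]
        have h4 : ‖((Real.log ‖f y‖ : ℝ) : ℂ) - Q y‖ ^ 2 ≤
            2 * ε ^ 2 + 2 * |Real.log ‖f y‖ - truncLog k ‖f y‖| ^ 2 := by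
          nlinarith [norm_nonneg (((Real.log ‖f y‖ : ℝ) : ℂ) - Q y),
            sq_nonneg (|Real.log ‖f y‖ - truncLog k ‖f y‖| - ε)]
        rw [← ofReal_norm, ← ENNReal.ofReal_pow (norm_nonneg _), Real.enorm_eq_ofReal_abs,
          ← ENNReal.ofReal_pow (abs_nonneg _), ← ENNReal.ofReal_ofNat 2,
          ← ENNReal.ofReal_mul zero_le_two, ← ENNReal.ofReal_add (by positivity) (by positivity)]
        exact ENNReal.ofReal_le_ofReal h4
    _ = ENNReal.ofReal (2 * ε ^ 2) * ENNReal.ofReal (2 * L) +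
          2 * ∫⁻ y in Set.Icc (-L) L, ‖Real.log ‖f y‖ - truncLog k ‖f y‖‖ₑ ^ 2 := by
        rw [lintegral_add_left measurable_const, lintegral_const_mul' _ _ ENNReal.ofNat_ne_top]
        simp only [lintegral_const, Measure.restrict_apply_univ, Real.volume_Icc]
        ring_nf
    _ ≤ ENNReal.ofReal (2 * ε ^ 2) * ENNReal.ofReal (2 * L) +
          2 * ENNReal.ofReal (B / k * (2 * L)) := by gcongr
    _ = _ := by
        rw [← ENNReal.ofReal_ofNat 2, ← ENNReal.ofReal_mul zero_le_two,
          ← ENNReal.ofReal_mul (by positivity), ← ENNReal.ofReal_mul (by positivity),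
          ← ENNReal.ofReal_add (by positivity) (by positivity)]
        ring_nf

/-- The logarithm of the modulus of the restriction of a continuous function on the torus to a line
is almost periodic in mean square, provided that the mean of `|log |f|| ^ 3` is bounded. -/
theorem isBesicovitchAP_log {d : ℕ} (r : Fin d → ℝ)
    {f : ℝ → ℂ} (hf : Continuous f) (hf0 : ∀ᵐ y, f y ≠ 0) {B : ℝ}
    (hB0 : 0 ≤ B) (hB : ∀ L : ℝ, 1 ≤ L → ∫⁻ y in Set.Icc (-L) L, ‖Real.log ‖f y‖‖ₑ ^ 3 ≤
      ENNReal.ofReal (B * (2 * L))) (F : C(UnitAddTorus (Fin d), ℂ))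
    (hF : ∀ y, f y = F (torusMk fun i => r i * y)) :
    IsBesicovitchAP fun y => ((Real.log ‖f y‖ : ℝ) : ℂ) := by
  refine ⟨fun L => (memLp_log_norm hf hB L).ofReal, fun ε hε => ?_⟩
  obtain ⟨η, -, hη0, hηε⟩ := ENNReal.lt_iff_exists_real_btwn.1 hε
  have hη : 0 < η := ENNReal.ofReal_pos.1 hη0
  -- Truncation will contribute `2 B / k ≤ η / 2`, and uniform approximation within `√η / 2` another
  -- `2 (√η / 2) ^ 2 = η / 2`.
  obtain ⟨k, hk⟩ := exists_nat_gt (4 * B / η)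
  have hk0 : (0 : ℝ) < k := lt_of_le_of_lt (by positivity) hk
  set G : C(UnitAddTorus (Fin d), ℂ) := ⟨fun z => (truncLogNorm k F z : ℂ), by fun_prop⟩ with hGdef
  have hG : G ∈ closure (Submodule.span ℂ (Set.range (UnitAddTorus.mFourier (d := Fin d))) :
      Set C(UnitAddTorus (Fin d), ℂ)) := by
    rw [← Submodule.topologicalClosure_coe, UnitAddTorus.span_mFourier_closure_eq_top]
    trivial
  obtain ⟨q, hq, hGq⟩ := Metric.mem_closure_iff.1 hG (Real.sqrt η / 2) (by positivity)
  obtain ⟨c, hc⟩ := exists_genTrigPoly_eq r hq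
  refine ⟨c, lt_of_le_of_lt (besicovitchSq_le_of_forall fun L hL =>
    lintegral_log_sub_le (ε := Real.sqrt η / 2) hf0 hB0 hB (Nat.cast_pos.1 hk0)
      (fun y => ?_) hL) (lt_of_le_of_lt (ENNReal.ofReal_le_ofReal ?_) hηε)⟩
  · have h1 := (ContinuousMap.dist_apply_le_dist (f := G) (g := q)
      (torusMk fun i => r i * y)).trans hGq.le
    rw [dist_eq_norm] at h1
    rw [hc, hF]
    exact h1
  · have h1 : B / k ≤ η / 4 := by
      rw [div_lt_iff₀ hη] at hk
      rw [div_le_iff₀ hk0]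
      linarith
    have h2 : (Real.sqrt η / 2) ^ 2 = η / 4 := by
      rw [div_pow, Real.sq_sqrt hη.le]
      norm_num
    rw [h2]
    linarith

/-! ### Laurent polynomials on the torus -/

/-- A Laurent polynomial as a continuous function on the torus. -/
def LaurentPoly.toTorus {d : ℕ} (P : LaurentPoly d) : C(UnitAddTorus (Fin d), ℂ) :=
  ∑ n ∈ P.coeff.support, P.coeff n • UnitAddTorus.mFourier n

lemma LaurentPoly.onTorus_eq_sum {d : ℕ} (P : LaurentPoly d) (t : Fin d → ℝ) :
    P.onTorus t = P.coeff.sum fun n a => a * ∏ i, expChar (n i * t i) := by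
  simp only [← expChar_zpow]
  rfl

lemma LaurentPoly.onTorus_eq_toTorus {d : ℕ} (P : LaurentPoly d) (t : Fin d → ℝ) :
    P.onTorus t = P.toTorus (torusMk t) := by
  rw [P.onTorus_eq_sum, LaurentPoly.toTorus, ContinuousMap.sum_apply]
  simp only [ContinuousMap.smul_apply, mFourier_torusMk, smul_eq_mul, Finsupp.sum]

lemma LaurentPoly.onTorus_sum_single {d : ℕ} {ι : Type*} [Fintype ι] (n : ι → Fin d → ℤ)
    (c : ι → ℂ) (t : Fin d → ℝ) :
    (∑ j, AddMonoidAlgebra.single (n j) (c j) : LaurentPoly d).onTorus t =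
      ∑ j, c j * ∏ i, expChar (n j i * t i) := by
  rw [LaurentPoly.onTorus_eq_sum, AddMonoidAlgebra.coeff_sum,
    ← Finsupp.sum_finsetSum_index (by simp) (by simp [add_mul])]
  refine Finset.sum_congr rfl fun j _ => ?_
  rw [AddMonoidAlgebra.coeff_single, Finsupp.sum_single_index (by simp)]

/-- Finitely many reals are integral combinations of rationally independent reals whose number is
the dimension of their rational span. -/
lemma exists_linearIndependent_int_coeff {ι : Type*} [Finite ι] (τ : ι → ℝ) :
    ∃ r : Fin (Module.finrank ℚ (Submodule.span ℚ (Set.range τ))) → ℝ, LinearIndependent ℚ r ∧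
      ∃ n : ι → Fin (Module.finrank ℚ (Submodule.span ℚ (Set.range τ))) → ℤ,
        ∀ j, τ j = ∑ i, n j i * r i := by
  set V := Submodule.span ℚ (Set.range τ)
  have : FiniteDimensional ℚ V := FiniteDimensional.span_of_finite ℚ (Set.finite_range τ)
  set b := Module.finBasis ℚ V
  set v : ι → V := fun j => ⟨τ j, Submodule.subset_span ⟨j, rfl⟩⟩
  -- `N` is a common denominator of all coordinates of the `τ j` in the basis `b`; rescaling `b` by
  -- `1 / N` makes them integers.
  obtain ⟨N, hN⟩ := IsLocalization.exist_integer_multiples_of_finite (nonZeroDivisors ℤ)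
    (fun p : ι × Fin (Module.finrank ℚ V) => b.repr (v p.1) p.2)
  have hN0 : ((N : ℤ) : ℚ) ≠ 0 := by exact_mod_cast nonZeroDivisors.coe_ne_zero N
  choose n hn using hN
  refine ⟨fun i => ((N : ℤ) : ℚ)⁻¹ • (b i : ℝ), ?_, fun j i => n (j, i), fun j => ?_⟩
  · have h1 : LinearIndependent ℚ fun i => (b i : ℝ) :=
      b.linearIndependent.map' V.subtype V.ker_subtype
    exact h1.units_smul fun _ => (Units.mk0 _ hN0)⁻¹
  · have h1 := congrArg (V.subtype) (b.sum_repr (v j))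
    rw [map_sum] at h1
    change _ = τ j at h1
    rw [← h1]
    refine Finset.sum_congr rfl fun i _ => ?_
    have h2 : ((n (j, i) : ℤ) : ℚ) = (N : ℤ) * b.repr (v j) i := by
      simpa using hn (j, i)
    have h3 : b.repr (v j) i = n (j, i) * ((N : ℤ) : ℚ)⁻¹ := by
      rw [h2]
      field_simp
    rw [map_smul, h3]
    simp [Rat.smul_def, mul_assoc]

lemma trigA_eq_expSum {m : ℕ} (lam : ℝ) (a : Fin m → ℂ) (τ : Fin m → ℝ) (y : ℝ) :
    trigA lam a τ y = expSum (fun j => ((|lam|⁻¹ : ℝ) : ℂ) * a j) τ y := by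
  simp only [trigA, expSum, expChar, Finset.mul_sum, Complex.ofReal_mul, mul_assoc]

end

theorem theorem1 {m : ℕ} (lam : ℝ) (hlam : 1 < |lam|) (a : Fin m → ℂ) (ha : ∀ j, a j ≠ 0)
    (hsum : ∑ j, a j = ((|lam| : ℝ) : ℂ)) (τ : Fin m → ℝ) (hτ : StrictMono τ) :
    -- `ln |A|` is almost periodic in the mean-square sense of Besicovitch
    IsBesicovitchAP (fun y => ((Real.log ‖trigA lam a τ y‖ : ℝ) : ℂ)) ∧
    -- `A` can be written as `P(e^{2πi r₁ y}, …, e^{2πi r_d y})`, where `d` is the rational rank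
    -- of the frequencies of `A` and `r₁, …, r_d` are rationally independent
    (∃ (r : Fin (Module.finrank ℚ (Submodule.span ℚ (Set.range τ))) → ℝ)
        (P : LaurentPoly (Module.finrank ℚ (Submodule.span ℚ (Set.range τ)))),
      LinearIndependent ℚ r ∧ ∀ y : ℝ, trigA lam a τ y = P.onTorus fun i => r i * y) ∧
    -- for every such representation, the mean value of `ln |A|` is `ln M(P)`
    ∀ (d : ℕ) (r : Fin d → ℝ) (P : LaurentPoly d), LinearIndependent ℚ r →
      (∀ y : ℝ, trigA lam a τ y = P.onTorus fun i => r i * y) →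
      IntegrableOn (fun t => Real.log ‖P.onTorus t‖) (Set.Icc (0 : Fin d → ℝ) 1) ∧
      Tendsto (fun L : ℝ => 1 / (2 * L) * ∫ y in (-L)..L, Real.log ‖trigA lam a τ y‖) atTop
        (𝓝 (Real.log P.mahler)) := by
  -- The coefficients have nonzero sum, so there is at least one term.
  obtain ⟨j, -⟩ : ∃ j, a j ≠ 0 := by
    by_contra! h
    have h0 : ∑ j, a j = 0 := Finset.sum_eq_zero fun j _ => h j
    rw [hsum, Complex.ofReal_eq_zero] at h0
    linarith
  set c : Fin m → ℂ := fun j => ((|lam|⁻¹ : ℝ) : ℂ) * a j with hc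
  have hA : trigA lam a τ = expSum c τ := funext (trigA_eq_expSum lam a τ)
  have hcj : c j ≠ 0 := mul_ne_zero
    (Complex.ofReal_ne_zero.2 (inv_ne_zero (by linarith))) (ha j)
  have hcont : Continuous (trigA lam a τ) := hA ▸ continuous_expSum c τ
  have hA0 : ∀ᵐ y, trigA lam a τ y ≠ 0 := hA ▸ ae_expSum_ne_zero hτ.injective hcj
  obtain ⟨B, hB0, hB⟩ := exists_lintegral_log_expSum_le hτ.injective hcj
  rw [← hA] at hB
  obtain ⟨r, hr, n, hn⟩ := exists_linearIndependent_int_coeff τ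
  have hrep : ∀ y, trigA lam a τ y =
      (∑ j, AddMonoidAlgebra.single (n j) (c j) : LaurentPoly _).onTorus fun i => r i * y := by
    intro y
    rw [LaurentPoly.onTorus_sum_single, hA, expSum]
    refine Finset.sum_congr rfl fun j _ => ?_
    rw [hn j, Finset.sum_mul, expChar_sum]
    simp only [mul_assoc]
  refine ⟨isBesicovitchAP_log r hcont hA0 hB0 hB _ fun y =>
    (hrep y).trans (LaurentPoly.onTorus_eq_toTorus _ _), ⟨r, _, hr, hrep⟩, ?_⟩
  -- The bound `B` was obtained from `A` alone, so it applies to every representation.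
  intro d r P hr hP
  simp only [LaurentPoly.mahler, Real.log_exp, LaurentPoly.onTorus_eq_toTorus]
  exact integrableOn_and_tendsto_mean_log hr hcont hA0 hB0 hB P.toTorus fun y =>
    (hP y).trans (LaurentPoly.onTorus_eq_toTorus _ _)
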